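/- All graphs are finite, simple and undirected. Let $G$ be a graph on $n$ vertices; $d$ denotes degree in $G$ and $N(x)$ the neighbourhood of $x$ in $G$. A vertex $v$ is \emph{heavy} in $G$ if $d(v)\ge n/2$. A pair $\{u,v\}$ of distinct vertices with $d(u)+d(v)\ge n$ is an \emph{$o$-heavy pair} of $G$ if $uv\notin E(G)$ and an \emph{$a$-heavy pair} of $G$ if $uv\in E(G)$. $G$ is \emph{claw-$o$-heavy} if every induced subgraph of $G$ isomorphic to $K_{1,3}$ contains an $o$-heavy pair of $G$. A \emph{net} is a triangle $a_1a_2a_3$ together with three pendant edges $a_1b_1,a_2b_2,a_3b_3$. An induced net of $G$ is \emph{$p$-heavy} if its triangle contains an $a$-heavy pair of $G$. It is \emph{$q$-heavy} if for some $i\in\{1,2,3\}$ the vertices $a_i$ and $b_i$ are heavy in $G$ and, for each $j\in\{1,2,3\}\setminus\{i\}$, $d(a_j)=3$, $d(b_j)=2$ and the neighbour of $b_j$ other than $a_j$ is heavy in $G$. $G$ is \emph{$N$-$pq$-heavy} if every induced net of $G$ is $p$-heavy or $q$-heavy. For a vertex $x$ let $G^{BC}_x$ be the graph obtained from $G$ by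 adding all edges $uv$ with $u,v\in N(x)$ and $\{u,v\}$ an $o$-heavy pair of $G$. The vertex $x$ is \emph{$c$-eligible} in $G$ if $N(x)$ is not a clique of $G$ and either (i) $G^{BC}_x[N(x)]$ is connected, or (ii) $G^{BC}_x[N(x)]$ is the disjoint union of two (nonempty) cliques $C_1,C_2$, and there is an $o$-heavy pair $\{x,z\}$ of $G$ with $zy_1,zy_2\in E(G)$ for some $y_1\in C_1$, $y_2\in C_2$. The \emph{local $c$-completion} of $G$ at $x$ is obtained from $G$ by joining all pairs of distinct nonadjacent vertices of $N(x)$. A \emph{$c$-closure} $\mathrm{cl}_c(G)$ of $G$ is any graph without $c$-eligible vertices that is obtained from $G$ by successively performing local $c$-completions, each at a vertex that is $c$-eligible in the current graph (the process always terminates). \textbf{Lemma.} If $G$ is claw-$o$-heavy and $N$-$pq$-heavy, then $\mathrm{cl}_c(G)$ is $N$-$pq$-heavy (with heaviness and degrees now taken in $\mathrm{cl}_c(G)$), whichever sequence of local $c$-completions is chosen. -/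

import Mathlib

namespace CClosure

/-- The net: `Sum.inl i` is the triangle vertex `aᵢ`, `Sum.inr i` is the pendant vertex `bᵢ`
attached to `aᵢ`. -/
def net : SimpleGraph (Fin 3 ⊕ Fin 3) where
  Adj
    | .inl i, .inl j => i ≠ j
    | .inl i, .inr j => i = j
    | .inr i, .inl j => i = j
    | .inr _, .inr _ => False
  symm := ⟨by rintro (i | i) (j | j) h <;> simp_all [eq_comm]⟩
  loopless := ⟨by rintro (i | i) h <;> simp_all⟩

/-- The claw `K_{1,3}`. -/
abbrev claw : SimpleGraph (Fin 1 ⊕ Fin 3) := completeBipartiteGraph (Fin 1) (Fin 3)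

variable {V : Type*} [Fintype V]

open Classical in
/-- The degree sum of `u` and `v` is at least the number of vertices. -/
def LargeDegreeSum (G : SimpleGraph V) (u v : V) : Prop :=
  Fintype.card V ≤ G.degree u + G.degree v

open Classical in
/-- `v` is heavy: its degree is at least half the number of vertices. -/
def IsHeavy (G : SimpleGraph V) (v : V) : Prop :=
  (Fintype.card V : ℚ) / 2 ≤ G.degree v

/-- `{u, v}` is an `o`-heavy pair: distinct nonadjacent vertices with degree sum at least `|V|`. -/
def IsOHeavyPair (G : SimpleGraph V) (u v : V) : Prop :=
  u ≠ v ∧ ¬ G.Adj u v ∧ LargeDegreeSum G u v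

/-- `{u, v}` is an `a`-heavy pair: adjacent vertices with degree sum at least `|V|`. -/
def IsAHeavyPair (G : SimpleGraph V) (u v : V) : Prop :=
  G.Adj u v ∧ LargeDegreeSum G u v

/-- `G` is `H`-`o`-heavy: every induced copy of `H` in `G` contains an `o`-heavy pair of `G`. -/
def IsOHeavyFor {W : Type*} (H : SimpleGraph W) (G : SimpleGraph V) : Prop :=
  ∀ f : H ↪g G, ∃ s t : W, IsOHeavyPair G (f s) (f t)

/-- The induced net `f` of `G` is `p`-heavy: its triangle contains an `a`-heavy pair of `G`. -/
def IsPHeavyNet (G : SimpleGraph V) (f : net ↪g G) : Prop :=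
  ∃ i j : Fin 3, IsAHeavyPair G (f (.inl i)) (f (.inl j))

open Classical in
/-- The induced net `f` of `G` is `q`-heavy: for some `i`, the vertices `aᵢ`, `bᵢ` are heavy, and
for `j ≠ i` we have `d(aⱼ) = 3`, `d(bⱼ) = 2` and the neighbour of `bⱼ` other than `aⱼ` is heavy. -/
def IsQHeavyNet (G : SimpleGraph V) (f : net ↪g G) : Prop :=
  ∃ i : Fin 3, IsHeavy G (f (.inl i)) ∧ IsHeavy G (f (.inr i)) ∧
    ∀ j : Fin 3, j ≠ i →
      G.degree (f (.inl j)) = 3 ∧ G.degree (f (.inr j)) = 2 ∧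
        ∀ c : V, G.Adj (f (.inr j)) c → c ≠ f (.inl j) → IsHeavy G c

/-- `G` is `N`-`pq`-heavy: every induced net of `G` is `p`-heavy or `q`-heavy. -/
def IsNPQHeavy (G : SimpleGraph V) : Prop :=
  ∀ f : net ↪g G, IsPHeavyNet G f ∨ IsQHeavyNet G f

/-- The graph `G^{BC}_x`: add to `G` the edges `uv` for all `o`-heavy pairs `{u, v}` of `G` with
`u, v ∈ N(x)`. -/
def bcGraph (G : SimpleGraph V) (x : V) : SimpleGraph V :=
  G ⊔ SimpleGraph.fromRel fun u v =>
    u ∈ G.neighborSet x ∧ v ∈ G.neighborSet x ∧ IsOHeavyPair G u v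

/-- `x` is `c`-eligible: `N(x)` is not a clique of `G`, and either `G^{BC}_x[N(x)]` is
connected, or it is the disjoint union of two cliques `C₁`, `C₂` and `x` is in an `o`-heavy pair
`{x, z}` of `G` such that `z` has a neighbour in `C₁` and a neighbour in `C₂`. -/
def IsCEligible (G : SimpleGraph V) (x : V) : Prop :=
  ¬ G.IsClique (G.neighborSet x) ∧
    (((bcGraph G x).induce (G.neighborSet x)).Connected ∨
      ∃ C₁ C₂ : Set V, C₁.Nonempty ∧ C₂.Nonempty ∧ Disjoint C₁ C₂ ∧
        C₁ ∪ C₂ = G.neighborSet x ∧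
        (bcGraph G x).IsClique C₁ ∧ (bcGraph G x).IsClique C₂ ∧
        (∀ y₁ ∈ C₁, ∀ y₂ ∈ C₂, ¬ (bcGraph G x).Adj y₁ y₂) ∧
        ∃ z : V, IsOHeavyPair G x z ∧ (∃ y₁ ∈ C₁, G.Adj z y₁) ∧ (∃ y₂ ∈ C₂, G.Adj z y₂))

/-- The local completion `G^o_x` of `G` at `x`: all pairs of distinct vertices in `N(x)` are
joined. -/
def localCompletion (G : SimpleGraph V) (x : V) : SimpleGraph V :=
  G ⊔ SimpleGraph.fromRel fun u v => u ∈ G.neighborSet x ∧ v ∈ G.neighborSet x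

/-- One step of the closure process: `H` is the local completion of `G` at a `c`-eligible vertex. -/
def CStep (G H : SimpleGraph V) : Prop :=
  ∃ x : V, IsCEligible G x ∧ H = localCompletion G x

/-- `H` is a `c`-closure of `G`: it arises from `G` by a finite sequence of local completions at
`c`-eligible vertices, and it has no `c`-eligible vertex. -/
def IsCClosure (G H : SimpleGraph V) : Prop :=
  Relation.ReflTransGen CStep G H ∧ ∀ x : V, ¬ IsCEligible H x

theorem lt_localCompletion {G : SimpleGraph V} {x : V} (hx : IsCEligible G x) :
    G < localCompletion G x := by
  refine lt_of_le_of_ne le_sup_left fun h => hx.1 ?_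
  intro u hu v hv huv
  rw [h]
  exact Or.inr ((SimpleGraph.fromRel_adj _ _ _).2 ⟨huv, Or.inl ⟨hu, hv⟩⟩)

/-- The closure process terminates, so every finite graph has a `c`-closure. -/
theorem exists_isCClosure (G : SimpleGraph V) : ∃ H : SimpleGraph V, IsCClosure G H := by
  induction G using WellFoundedGT.induction with
  | ind G ih =>
    by_cases h : ∃ x : V, IsCEligible G x
    · obtain ⟨x, hx⟩ := h
      obtain ⟨H, hH, hH'⟩ := ih _ (lt_localCompletion hx)
      exact ⟨H, Relation.ReflTransGen.head ⟨x, hx, rfl⟩ hH, hH'⟩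
    · exact ⟨G, Relation.ReflTransGen.refl, fun x hx => h ⟨x, hx⟩⟩

end CClosure

/-! The closure has no $o$-heavy pair, so an invariant that tolerates such pairs suffices along the
way. Each step preserves claw-$o$-heaviness together with `NetGood`: every induced net is $p$-heavy,
$q$-heavy or contains an $o$-heavy pair. In the closure the last option is void.

Preservation rests on an exchange: after completing at $x$, every old neighbour of $x$ has degree at
least $d(x)$ and so may replace $x$ in any large degree sum. A claw or net with a new edge is
compared with a claw or net of the old graph, usually one through $x$ (`ClawOHeavy.localCompletion`,
`NetGood.of_pendant`, `NetGood.of_triangle`). If a net was already induced before the step,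
heaviness only grows, and the danger is that $q$-heaviness is lost because a vertex of degree 2 or 3
gains edges. Then $x$ would be next to that vertex; eligibility of $x$ would demand an $o$-heavy
pair too large for the degrees at hand (`IsCEligible.exists_of_isolated`,
`IsQNet.not_largeDegreeSum`).

For the absence of $o$-heavy pairs (`ClawOHeavy.not_isOHeavyPair`), suppose $\{u,v\}$ is one. Each
common neighbour $t$ is ineligible, so its neighbourhood has a vertex $w(t)$ outside the
$G^{BC}_t$-component of $u$ and $v$. The map $w$ is injective into the vertices outside $N(u)\cup
N(v)\cup\{u,v\}$, which gives $d(u)+d(v)\le n-2$. -/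

namespace CClosure

open Classical in
/-- The degree, with the classical decidability instance. -/
noncomputable def deg {V : Type*} [Fintype V] (G : SimpleGraph V) (v : V) : ℕ := G.degree v

/-! ### Degree bounds from neighbours and non-neighbours -/

section Degrees

variable {V : Type*} [Fintype V] {G H : SimpleGraph V}

theorem largeDegreeSum_iff {u v : V} :
    LargeDegreeSum G u v ↔ Fintype.card V ≤ deg G u + deg G v := Iff.rfl

theorem isHeavy_iff {v : V} : IsHeavy G v ↔ Fintype.card V ≤ 2 * deg G v := by
  unfold IsHeavy deg
  rw [div_le_iff₀ (by norm_num), mul_comm]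
  exact_mod_cast Iff.rfl

theorem LargeDegreeSum.symm {u v : V} (h : LargeDegreeSum G u v) : LargeDegreeSum G v u := by
  rw [largeDegreeSum_iff] at *
  omega

theorem IsHeavy.largeDegreeSum {u v : V} (hu : IsHeavy G u) (hv : IsHeavy G v) :
    LargeDegreeSum G u v := by
  rw [isHeavy_iff] at hu hv
  rw [largeDegreeSum_iff]
  omega

theorem deg_mono (h : G ≤ H) (v : V) : deg G v ≤ deg H v := by
  classical
  unfold deg
  rw [← SimpleGraph.card_neighborFinset_eq_degree, ← SimpleGraph.card_neighborFinset_eq_degree]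
  refine Finset.card_le_card fun w hw => ?_
  simp only [SimpleGraph.mem_neighborFinset] at *
  exact h hw

theorem LargeDegreeSum.mono (h : G ≤ H) {u v : V} (huv : LargeDegreeSum G u v) :
    LargeDegreeSum H u v := by
  have h1 := deg_mono h u
  have h2 := deg_mono h v
  rw [largeDegreeSum_iff] at *
  omega

theorem IsHeavy.mono (h : G ≤ H) {v : V} (hv : IsHeavy G v) : IsHeavy H v := by
  have h1 := deg_mono h v
  rw [isHeavy_iff] at *
  omega

/-- The set may contain `v` itself, which is never its own neighbour; hence the constants 3 and 4
for two and three further non-neighbours. -/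
theorem deg_add_card_le {v : V} (s : Finset V) (hs : ∀ y ∈ s, ¬ G.Adj v y) :
    deg G v + s.card ≤ Fintype.card V := by
  classical
  unfold deg
  rw [← SimpleGraph.card_neighborFinset_eq_degree, ← Finset.card_union_of_disjoint]
  · exact Finset.card_le_univ _
  · rw [Finset.disjoint_left]
    intro y hy hy'
    exact hs y hy' (by simpa using hy)

/-- A vertex with two distinct non-neighbours has degree at most `|V| - 3`. -/
theorem deg_add_three_le {v p q : V} (hp : v ≠ p) (hq : v ≠ q) (hpq : p ≠ q)
    (hvp : ¬ G.Adj v p) (hvq : ¬ G.Adj v q) : deg G v + 3 ≤ Fintype.card V := by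
  classical
  have := deg_add_card_le (G := G) (v := v) {v, p, q} (by simp [hvp, hvq])
  rwa [Finset.card_eq_three.2 ⟨v, p, q, hp, hq, hpq, rfl⟩] at this

/-- A vertex with three distinct non-neighbours has degree at most `|V| - 4`. -/
theorem deg_add_four_le {v p q r : V} (hp : v ≠ p) (hq : v ≠ q) (hr : v ≠ r) (hpq : p ≠ q)
    (hpr : p ≠ r) (hqr : q ≠ r) (hvp : ¬ G.Adj v p) (hvq : ¬ G.Adj v q) (hvr : ¬ G.Adj v r) :
    deg G v + 4 ≤ Fintype.card V := by
  classical
  have := deg_add_card_le (G := G) (v := v) {v, p, q, r} (by simp [hvp, hvq, hvr])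
  rwa [show ({v, p, q, r} : Finset V).card = 4 by
    rw [Finset.card_insert_of_notMem (by simp [hp, hq, hr]),
      Finset.card_eq_three.2 ⟨p, q, r, hpq, hpr, hqr, rfl⟩]] at this

theorem deg_le_card {v : V} (s : Finset V) (hs : ∀ y, G.Adj v y → y ∈ s) :
    deg G v ≤ s.card := by
  classical
  unfold deg
  rw [← SimpleGraph.card_neighborFinset_eq_degree]
  exact Finset.card_le_card fun y hy => hs y (by simpa using hy)

theorem card_le_deg {v : V} (s : Finset V) (hs : ∀ y ∈ s, G.Adj v y) :
    s.card ≤ deg G v := by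
  classical
  unfold deg
  rw [← SimpleGraph.card_neighborFinset_eq_degree]
  exact Finset.card_le_card fun y hy => by simpa using hs y hy

theorem mem_of_deg_le_card {v : V} (s : Finset V) (hs : ∀ y ∈ s, G.Adj v y)
    (h : deg G v ≤ s.card) {y : V} (hy : G.Adj v y) : y ∈ s := by
  classical
  by_contra hys
  have := card_le_deg (G := G) (v := v) (insert y s) (by
    intro w hw
    rcases Finset.mem_insert.1 hw with rfl | hw
    · exact hy
    · exact hs w hw)
  rw [Finset.card_insert_of_notMem hys] at this
  omega

theorem deg_le_two {v p q : V} (h : ∀ y, G.Adj v y → y = p ∨ y = q) : deg G v ≤ 2 := by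
  classical
  exact (deg_le_card {p, q} (by simpa using h)).trans Finset.card_le_two

theorem deg_le_three {v p q r : V} (h : ∀ y, G.Adj v y → y = p ∨ y = q ∨ y = r) :
    deg G v ≤ 3 := by
  classical
  exact (deg_le_card {p, q, r} (by simpa using h)).trans Finset.card_le_three

end Degrees

/-! ### Local completions and eligibility -/

section LocalCompletion

variable {V : Type*} {G : SimpleGraph V} {x : V}

theorem localCompletion_adj {u v : V} :
    (localCompletion G x).Adj u v ↔ G.Adj u v ∨ (u ≠ v ∧ G.Adj x u ∧ G.Adj x v) := by
  simp only [localCompletion, SimpleGraph.sup_adj, SimpleGraph.fromRel_adj,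
    SimpleGraph.mem_neighborSet]
  tauto

theorem le_localCompletion : G ≤ localCompletion G x := le_sup_left

theorem localCompletion_adj_of_adj {u v : V} (huv : u ≠ v) (hu : G.Adj x u) (hv : G.Adj x v) :
    (localCompletion G x).Adj u v := localCompletion_adj.2 (Or.inr ⟨huv, hu, hv⟩)

theorem adj_of_localCompletion_adj_left {u v : V} (hu : ¬ G.Adj x u)
    (h : (localCompletion G x).Adj u v) : G.Adj u v :=
  (localCompletion_adj.1 h).resolve_right fun h' => hu h'.2.1

theorem adj_of_localCompletion_adj_right {u v : V} (hv : ¬ G.Adj x v)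
    (h : (localCompletion G x).Adj u v) : G.Adj u v :=
  (adj_of_localCompletion_adj_left hv h.symm).symm

theorem not_adj_of_localCompletion {u v : V} (h : ¬ (localCompletion G x).Adj u v) :
    ¬ G.Adj u v := fun h' => h (le_localCompletion h')

theorem adj_and_adj_of_new {u v : V} (h : (localCompletion G x).Adj u v) (hn : ¬ G.Adj u v) :
    G.Adj x u ∧ G.Adj x v := ((localCompletion_adj.1 h).resolve_left hn).2

variable [Fintype V]

/-- In the local completion at `x`, the neighbours of `x` have at least the degree of `x`. -/
theorem deg_le_deg_localCompletion {u : V} (hu : G.Adj x u) :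
    deg G x ≤ deg (localCompletion G x) u := by
  classical
  have hx : x ∉ (G.neighborFinset x).erase u := by simp
  have hu' : u ∈ G.neighborFinset x := by simpa using hu
  -- Exchanging `u` for `x` in $N(x)$ gives equally many neighbours of `u`.
  have h := card_le_deg (G := localCompletion G x) (v := u)
    (insert x ((G.neighborFinset x).erase u)) (by
      intro y hy
      rcases Finset.mem_insert.1 hy with rfl | hy
      · exact le_localCompletion hu.symm
      · rw [Finset.mem_erase, SimpleGraph.mem_neighborFinset] at hy
        exact localCompletion_adj_of_adj hy.1.symm hu hy.2)
  rw [Finset.card_insert_of_notMem hx, Finset.card_erase_of_mem hu'] at h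
  have hpos := Finset.card_pos.2 ⟨u, hu'⟩
  have hd : deg G x = (G.neighborFinset x).card := by
    unfold deg
    rw [← SimpleGraph.card_neighborFinset_eq_degree]
  omega

/-- The exchange principle: a completed neighbour inherits the degree sums of `x`. -/
theorem LargeDegreeSum.localCompletion_left {u v : V} (hu : G.Adj x u)
    (h : LargeDegreeSum G x v) : LargeDegreeSum (localCompletion G x) u v := by
  have h1 := deg_le_deg_localCompletion hu
  have h2 := deg_mono (le_localCompletion (G := G) (x := x)) v
  rw [largeDegreeSum_iff] at *
  omega

theorem IsHeavy.localCompletion {u : V} (hu : G.Adj x u) (h : IsHeavy G x) :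
    IsHeavy (localCompletion G x) u := by
  have h1 := deg_le_deg_localCompletion hu
  rw [isHeavy_iff] at *
  omega

theorem bcGraph_adj {u v : V} :
    (bcGraph G x).Adj u v ↔ G.Adj u v ∨ (G.Adj x u ∧ G.Adj x v ∧ IsOHeavyPair G u v) := by
  have hs : ∀ a b : V, IsOHeavyPair G a b → IsOHeavyPair G b a := fun a b h =>
    ⟨h.1.symm, fun h' => h.2.1 h'.symm, h.2.2.symm⟩
  simp only [bcGraph, SimpleGraph.sup_adj, SimpleGraph.fromRel_adj,
    SimpleGraph.mem_neighborSet]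
  constructor
  · rintro (h | ⟨-, h | h⟩)
    · exact Or.inl h
    · exact Or.inr h
    · exact Or.inr ⟨h.2.1, h.1, hs _ _ h.2.2⟩
  · rintro (h | h)
    · exact Or.inl h
    · exact Or.inr ⟨h.2.2.1, Or.inl h⟩

/-- If a neighbour `p` of a `c`-eligible vertex `x` is isolated in `G^{BC}_x[N(x)]`, then `p` is
adjacent to a vertex forming an `o`-heavy pair with `x`. -/
theorem IsCEligible.exists_of_isolated (hx : IsCEligible G x) {p : V} (hp : G.Adj x p)
    (hiso : ∀ w, G.Adj x w → ¬ (bcGraph G x).Adj p w) :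
    ∃ z, IsOHeavyPair G x z ∧ G.Adj z p := by
  obtain ⟨hcl, hconn | ⟨C₁, C₂, -, -, -, hU, h1, h2, -, z, hz, ⟨y₁, hy₁, hzy₁⟩, y₂, hy₂, hzy₂⟩⟩ := hx
  · exfalso
    -- A connected graph with an isolated vertex is a single vertex, and then $N(x)$ would be a
    -- clique.
    have hall : ∀ w, G.Adj x w → w = p := by
      intro w hw
      by_contra hne
      obtain ⟨W⟩ := hconn.preconnected ⟨p, hp⟩ ⟨w, hw⟩
      cases W with
      | nil => exact hne rfl
      | cons h _ => exact hiso _ (Subtype.property _) h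
    apply hcl
    intro u hu v hv huv
    exact absurd ((hall u hu).trans (hall v hv).symm) huv
  -- The clique containing the isolated vertex `p` is $\{p\}$, so `z` must see `p` itself.
  · have hp' : p ∈ C₁ ∪ C₂ := hU ▸ hp
    have hsub : ∀ y ∈ C₁ ∪ C₂, G.Adj x y := fun y hy => by rw [hU] at hy; exact hy
    rcases hp' with hp' | hp'
    · have : y₁ = p := by
        by_contra hne
        exact hiso y₁ (hsub _ (Or.inl hy₁)) (h1 hp' hy₁ (Ne.symm hne))
      exact ⟨z, hz, this ▸ hzy₁⟩
    · have : y₂ = p := by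
        by_contra hne
        exact hiso y₂ (hsub _ (Or.inr hy₂)) (h2 hp' hy₂ (Ne.symm hne))
      exact ⟨z, hz, this ▸ hzy₂⟩

end LocalCompletion

/-! ### Claw-$o$-heaviness is preserved -/

section Claws

variable {V : Type*} [Fintype V] {G : SimpleGraph V}

/-- Claw-`o`-heaviness in terms of the centre and the three leaves of a claw. -/
def ClawOHeavy (G : SimpleGraph V) : Prop :=
  ∀ c p q r : V, G.Adj c p → G.Adj c q → G.Adj c r → p ≠ q → p ≠ r → q ≠ r →
    ¬ G.Adj p q → ¬ G.Adj p r → ¬ G.Adj q r →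
    LargeDegreeSum G p q ∨ LargeDegreeSum G p r ∨ LargeDegreeSum G q r

theorem IsOHeavyFor.clawOHeavy (h : IsOHeavyFor claw G) : ClawOHeavy G := by
  intro c p q r hp hq hr hpq hpr hqr npq npr nqr
  have np := hp.ne
  have nq := hq.ne
  have nr := hr.ne
  let f : claw ↪g G :=
    { toFun := Sum.elim (fun _ => c) ![p, q, r]
      inj' := by
        rintro (i | i) (j | j) hij <;> fin_cases i <;> fin_cases j <;> simp_all
      map_rel_iff' := by
        have npq' : ¬ G.Adj q p := fun h => npq h.symm
        have npr' : ¬ G.Adj r p := fun h => npr h.symm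
        have nqr' : ¬ G.Adj r q := fun h => nqr h.symm
        intro i j
        change G.Adj (Sum.elim (fun _ => c) ![p, q, r] i) (Sum.elim (fun _ => c) ![p, q, r] j) ↔ _
        rcases i with i | i <;> rcases j with j | j <;> fin_cases i <;> fin_cases j <;>
          simp [hp, hq, hr, hp.symm, hq.symm, hr.symm, npq, npr, nqr, npq', npr', nqr'] }
  obtain ⟨s, t, h1, h2, h3⟩ := h f
  have hf1 : ∀ i, f (.inl i) = c := fun _ => rfl
  have hf2 : ∀ i, f (.inr i) = ![p, q, r] i := fun _ => rfl
  have hnot : ∀ i, ¬ ¬ G.Adj c (![p, q, r] i) := by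
    intro i
    fin_cases i <;> simp [hp, hq, hr]
  rcases s with s | s <;> rcases t with t | t
  · exact absurd rfl h1
  · exact absurd h2 (hnot t)
  · exact absurd (fun h => h2 h.symm) (hnot s)
  · rw [hf2, hf2] at h1 h3
    fin_cases s <;> fin_cases t
    · exact absurd rfl h1
    · exact Or.inl h3
    · exact Or.inr (Or.inl h3)
    · exact Or.inl h3.symm
    · exact absurd rfl h1
    · exact Or.inr (Or.inr h3)
    · exact Or.inr (Or.inl h3.symm)
    · exact Or.inr (Or.inr h3.symm)
    · exact absurd rfl h1

/-- Local completions preserve claw-`o`-heaviness. -/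
theorem ClawOHeavy.localCompletion (h : ClawOHeavy G) (x : V) :
    ClawOHeavy (localCompletion G x) := by
  -- A claw has at most one new edge, since two leaves in $N(x)$ would have been joined. If it is
  -- `cp`, replace the leaf `p` by `x` to get a claw of `G`, then exchange back.
  have aux : ∀ c p q r : V, ¬ G.Adj c p → (CClosure.localCompletion G x).Adj c p →
      (CClosure.localCompletion G x).Adj c q → (CClosure.localCompletion G x).Adj c r →
      p ≠ q → p ≠ r → q ≠ r → ¬ (CClosure.localCompletion G x).Adj p q →
      ¬ (CClosure.localCompletion G x).Adj p r → ¬ (CClosure.localCompletion G x).Adj q r →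
      LargeDegreeSum (CClosure.localCompletion G x) p q ∨
      LargeDegreeSum (CClosure.localCompletion G x) p r ∨
      LargeDegreeSum (CClosure.localCompletion G x) q r := by
    intro c p q r hcp hp hq hr hpq hpr hqr npq npr nqr
    rw [localCompletion_adj] at hp hq hr npq npr nqr
    have hxc : G.Adj x c := by tauto
    have hxp : G.Adj x p := by tauto
    have hxq : ¬ G.Adj x q := by tauto
    have hxr : ¬ G.Adj x r := by tauto
    have hxq' : x ≠ q := by rintro rfl; exact npq (Or.inl hxp.symm)
    have hxr' : x ≠ r := by rintro rfl; exact npr (Or.inl hxp.symm)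
    rcases h c x q r hxc.symm (by tauto) (by tauto) hxq' hxr' hqr hxq hxr (by tauto)
      with h | h | h
    · exact Or.inl (h.localCompletion_left hxp)
    · exact Or.inr (Or.inl (h.localCompletion_left hxp))
    · exact Or.inr (Or.inr (h.mono le_localCompletion))
  intro c p q r hp hq hr hpq hpr hqr npq npr nqr
  by_cases hp' : G.Adj c p
  · by_cases hq' : G.Adj c q
    · by_cases hr' : G.Adj c r
      · rcases h c p q r hp' hq' hr' hpq hpr hqr (fun h => npq (le_localCompletion h))
          (fun h => npr (le_localCompletion h)) (fun h => nqr (le_localCompletion h))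
          with h | h | h
        · exact Or.inl (h.mono le_localCompletion)
        · exact Or.inr (Or.inl (h.mono le_localCompletion))
        · exact Or.inr (Or.inr (h.mono le_localCompletion))
      · rcases aux c r p q hr' hr hp hq hpr.symm hqr.symm hpq (fun h => npr h.symm)
          (fun h => nqr h.symm) npq with h | h | h
        · exact Or.inr (Or.inl h.symm)
        · exact Or.inr (Or.inr h.symm)
        · exact Or.inl h
    · rcases aux c q p r hq' hq hp hr hpq.symm hqr hpr (fun h => npq h.symm)
        nqr npr with h | h | h
      · exact Or.inl h.symm
      · exact Or.inr (Or.inr h)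
      · exact Or.inr (Or.inl h)
  · exact aux c p q r hp' hp hq hr hpq hpr hqr npq npr nqr

end Claws

/-! ### No $o$-heavy pairs in the closure -/

section Closed

variable {V : Type*} [Fintype V] {G : SimpleGraph V}

/-- Among three neighbours of `u`, two are equal or adjacent in `G^{BC}_u`. -/
theorem ClawOHeavy.bcGraph_adj (h : ClawOHeavy G) {u p q r : V} (hp : G.Adj u p)
    (hq : G.Adj u q) (hr : G.Adj u r) (hpq : p ≠ q) (hpr : p ≠ r) (hqr : q ≠ r) :
    (bcGraph G u).Adj p q ∨ (bcGraph G u).Adj p r ∨ (bcGraph G u).Adj q r := by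
  simp only [CClosure.bcGraph_adj, IsOHeavyPair]
  have := h u p q r hp hq hr hpq hpr hqr
  tauto

/-- Two common neighbours of an `o`-heavy pair `{u, v}` with `u` not `c`-eligible are adjacent in
`G^{BC}_u`. -/
theorem ClawOHeavy.bcGraph_adj_of_isOHeavyPair (h : ClawOHeavy G) {u v s t : V}
    (hu : ¬ IsCEligible G u) (huv : IsOHeavyPair G u v) (hus : G.Adj u s) (hut : G.Adj u t)
    (hvs : G.Adj v s) (hvt : G.Adj v t) (hst : s ≠ t) : (bcGraph G u).Adj s t := by
  by_contra hadj
  apply hu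
  have hnst : ¬ G.Adj s t := fun h' => hadj (CClosure.bcGraph_adj.2 (Or.inl h'))
  refine ⟨fun hc => hnst (hc hus hut hst), ?_⟩
  by_cases hconn : ((bcGraph G u).induce (G.neighborSet u)).Connected
  · exact Or.inl hconn
  refine Or.inr ?_
  -- $G^{BC}_u[N(u)]$ has no three independent vertices; if disconnected, it consists of two
  -- cliques, the component `C` of `s` and the rest. Then `v` is the vertex `z` of condition (ii).
  let C : Set V := {y | ∃ hy : G.Adj u y,
    ((bcGraph G u).induce (G.neighborSet u)).Reachable ⟨s, hus⟩ ⟨y, hy⟩}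
  have hsC : s ∈ C := ⟨hus, SimpleGraph.Reachable.refl _⟩
  have hcross : ∀ y₁ ∈ C, ∀ y₂ ∈ G.neighborSet u \ C, ¬ (bcGraph G u).Adj y₁ y₂ := by
    rintro y₁ ⟨hy₁, hr⟩ y₂ ⟨hy₂, hn⟩ ha
    exact hn ⟨hy₂, hr.trans (SimpleGraph.Adj.reachable (by simpa using ha))⟩
  have hne : ∀ y₁ ∈ C, ∀ y₂ ∈ G.neighborSet u \ C, y₁ ≠ y₂ := by
    rintro y₁ h₁ y₂ h₂ rfl
    exact h₂.2 h₁
  have hC2 : (G.neighborSet u \ C).Nonempty := by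
    by_contra hemp
    rw [Set.not_nonempty_iff_eq_empty] at hemp
    apply hconn
    rw [SimpleGraph.connected_iff_exists_forall_reachable]
    refine ⟨⟨s, hus⟩, fun ⟨y, hy⟩ => ?_⟩
    by_contra hr
    have : y ∈ G.neighborSet u \ C := ⟨hy, fun ⟨_, hr'⟩ => hr hr'⟩
    simp [hemp] at this
  obtain ⟨w, hw⟩ := hC2
  have hcl1 : (bcGraph G u).IsClique C := by
    intro y hy y' hy' hyy
    rcases h.bcGraph_adj hy.1 hy'.1 hw.1 hyy (hne _ hy _ hw) (hne _ hy' _ hw) with h1 | h1 | h1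
    · exact h1
    · exact absurd h1 (hcross _ hy _ hw)
    · exact absurd h1 (hcross _ hy' _ hw)
  have hcl2 : (bcGraph G u).IsClique (G.neighborSet u \ C) := by
    intro y hy y' hy' hyy
    rcases h.bcGraph_adj hus hy.1 hy'.1 (hne _ hsC _ hy) (hne _ hsC _ hy') hyy with h1 | h1 | h1
    · exact absurd h1 (hcross _ hsC _ hy)
    · exact absurd h1 (hcross _ hsC _ hy')
    · exact h1
  have htC : t ∈ G.neighborSet u \ C := ⟨hut, fun htC => hadj (hcl1 hsC htC hst)⟩
  have hCsub : C ⊆ G.neighborSet u := fun y hy => hy.1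
  exact ⟨C, G.neighborSet u \ C, ⟨s, hsC⟩, ⟨w, hw⟩, Set.disjoint_sdiff_right,
    Set.union_sdiff_cancel hCsub, hcl1, hcl2, hcross, v, huv, ⟨s, hsC, hvs⟩, t, htC, hvt⟩

/-- A claw-`o`-heavy graph without `c`-eligible vertices has no `o`-heavy pair. -/
theorem ClawOHeavy.not_isOHeavyPair (h : ClawOHeavy G) (hcl : ∀ x, ¬ IsCEligible G x) (u v : V) :
    ¬ IsOHeavyPair G u v := by
  classical
  intro huv
  let R (t y z : V) : Prop := ∃ (hy : G.Adj t y) (hz : G.Adj t z),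
    ((bcGraph G t).induce (G.neighborSet t)).Reachable ⟨y, hy⟩ ⟨z, hz⟩
  have hRadj : ∀ t y z, G.Adj t y → G.Adj t z → (bcGraph G t).Adj y z → R t y z :=
    fun t y z hy hz ha => ⟨hy, hz, SimpleGraph.Adj.reachable (by simpa using ha)⟩
  have hRtrans : ∀ t y z w, R t y z → R t z w → R t y w :=
    fun t y z w ⟨hy, _, h1⟩ ⟨_, hw, h2⟩ => ⟨hy, hw, h1.trans h2⟩
  -- $N(t)$ is not a clique because of `u` and `v`, so ineligibility of `t` forces disconnectedness.
  have hex : ∀ t, G.Adj t u → G.Adj t v → ∃ w, G.Adj t w ∧ ¬ R t u w := by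
    intro t hu hv
    by_contra! hcon
    apply hcl t
    refine ⟨fun hc => huv.2.1 (hc hu hv huv.1), Or.inl ?_⟩
    rw [SimpleGraph.connected_iff_exists_forall_reachable]
    refine ⟨⟨u, hu⟩, fun ⟨y, hy⟩ => ?_⟩
    obtain ⟨_, _, hr⟩ := hcon y hy
    exact hr
  choose! w hw hwR using hex
  have hRuv : ∀ t, G.Adj t u → G.Adj t v → R t u v := fun t hu hv =>
    hRadj t u v hu hv (CClosure.bcGraph_adj.2 (Or.inr ⟨hu, hv, huv⟩))
  have hwu : ∀ t, G.Adj t u → G.Adj t v → u ≠ w t ∧ v ≠ w t ∧ ¬ G.Adj u (w t) ∧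
      ¬ G.Adj v (w t) := by
    intro t hu hv
    refine ⟨?_, ?_, ?_, ?_⟩
    · intro he
      apply hwR t hu hv
      rw [← he]
      exact ⟨hu, hu, SimpleGraph.Reachable.refl _⟩
    · intro he
      apply hwR t hu hv
      rw [← he]
      exact hRuv t hu hv
    · intro ha
      exact hwR t hu hv (hRadj _ _ _ hu (hw t hu hv) (CClosure.bcGraph_adj.2 (Or.inl ha)))
    · intro ha
      exact hwR t hu hv (hRtrans _ _ _ _ (hRuv t hu hv)
        (hRadj _ _ _ hv (hw t hu hv) (CClosure.bcGraph_adj.2 (Or.inl ha))))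
  -- The vertices `s`, `t` are adjacent in $G^{BC}_u$. If adjacent in `G`, the path `u`, `t`, `w s`
  -- connects inside $N(s)$. If $o$-heavy, `u` and `w s` are common neighbours of that pair, hence
  -- adjacent in $G^{BC}_s$.
  have hinj : ∀ s t, G.Adj s u → G.Adj s v → G.Adj t u → G.Adj t v → w s = w t → s = t := by
    intro s t hsu hsv htu htv he
    by_contra hst
    have hsw := hw s hsu hsv
    have htw := hw t htu htv
    have hnR := hwR s hsu hsv
    rw [← he] at htw
    rcases CClosure.bcGraph_adj.1 (h.bcGraph_adj_of_isOHeavyPair (hcl u) huv hsu.symm htu.symm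
      hsv.symm htv.symm hst) with hadj | ⟨-, -, hoh⟩
    · exact hnR (hRtrans _ _ _ _
        (hRadj s u t hsu hadj (CClosure.bcGraph_adj.2 (Or.inl htu.symm)))
        (hRadj s t (w s) hadj hsw (CClosure.bcGraph_adj.2 (Or.inl htw))))
    · exact hnR (hRadj s u (w s) hsu hsw
        (h.bcGraph_adj_of_isOHeavyPair (hcl s) hoh hsu hsw htu htw (hwu s hsu hsv).1))
  let A := G.neighborFinset u
  let B := G.neighborFinset v
  have hcard : (A ∩ B).card ≤ ((A ∪ B ∪ {u, v})ᶜ).card := by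
    refine Finset.card_le_card_of_injOn w ?_ ?_
    · intro t ht
      simp only [A, B, Finset.coe_inter, Set.mem_inter_iff, Finset.mem_coe,
        SimpleGraph.mem_neighborFinset] at ht
      obtain ⟨h1, h2, h3, h4⟩ := hwu t ht.1.symm ht.2.symm
      simp [A, B, h1.symm, h2.symm, h3, h4]
    · intro s hs t ht he
      simp only [A, B, Finset.coe_inter, Set.mem_inter_iff, Finset.mem_coe,
        SimpleGraph.mem_neighborFinset] at hs ht
      exact hinj s t hs.1.symm hs.2.symm ht.1.symm ht.2.symm he
  have hdisj : Disjoint (A ∪ B) {u, v} := by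
    have h1 := huv.2.1
    have h2 : ¬ G.Adj v u := fun h' => h1 h'.symm
    rw [Finset.disjoint_right]
    intro y hy
    simp only [Finset.mem_insert, Finset.mem_singleton] at hy
    rcases hy with rfl | rfl <;> simp [A, B, h1, h2]
  rw [Finset.card_compl, Finset.card_union_of_disjoint hdisj, Finset.card_pair huv.1] at hcard
  have h1 := Finset.card_union_add_card_inter A B
  have h2 : Fintype.card V ≤ A.card + B.card := by
    have := largeDegreeSum_iff.1 huv.2.2
    unfold deg at this
    rw [← SimpleGraph.card_neighborFinset_eq_degree,
      ← SimpleGraph.card_neighborFinset_eq_degree] at this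
    convert this using 3
  have h3 := Finset.card_le_univ (A ∪ B ∪ {u, v})
  rw [Finset.card_union_of_disjoint hdisj, Finset.card_pair huv.1] at h3
  omega

end Closed

/-! ### Nets and the invariant for them -/

section Nets

variable {V : Type*} {G : SimpleGraph V}

/-- The vertices `a₁, a₂, a₃` and `b₁, b₂, b₃` span an induced net. -/
structure IsNet (G : SimpleGraph V) (a₁ a₂ a₃ b₁ b₂ b₃ : V) : Prop where
  a12 : G.Adj a₁ a₂
  a13 : G.Adj a₁ a₃
  a23 : G.Adj a₂ a₃
  p1 : G.Adj a₁ b₁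
  p2 : G.Adj a₂ b₂
  p3 : G.Adj a₃ b₃
  n12 : ¬ G.Adj a₁ b₂
  n13 : ¬ G.Adj a₁ b₃
  n21 : ¬ G.Adj a₂ b₁
  n23 : ¬ G.Adj a₂ b₃
  n31 : ¬ G.Adj a₃ b₁
  n32 : ¬ G.Adj a₃ b₂
  m12 : ¬ G.Adj b₁ b₂
  m13 : ¬ G.Adj b₁ b₃
  m23 : ¬ G.Adj b₂ b₃

namespace IsNet

variable {a₁ a₂ a₃ b₁ b₂ b₃ : V}

theorem swap12 (h : IsNet G a₁ a₂ a₃ b₁ b₂ b₃) : IsNet G a₂ a₁ a₃ b₂ b₁ b₃ :=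
  ⟨h.a12.symm, h.a23, h.a13, h.p2, h.p1, h.p3, h.n21, h.n23, h.n12, h.n13, h.n32, h.n31,
    fun h' => h.m12 h'.symm, h.m23, h.m13⟩

theorem swap23 (h : IsNet G a₁ a₂ a₃ b₁ b₂ b₃) : IsNet G a₁ a₃ a₂ b₁ b₃ b₂ :=
  ⟨h.a13, h.a12, h.a23.symm, h.p1, h.p3, h.p2, h.n13, h.n12, h.n31, h.n32, h.n21, h.n23,
    h.m13, h.m12, fun h' => h.m23 h'.symm⟩

theorem b12 (h : IsNet G a₁ a₂ a₃ b₁ b₂ b₃) : b₁ ≠ b₂ := by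
  rintro rfl
  exact h.n12 h.p1

theorem ne12 (h : IsNet G a₁ a₂ a₃ b₁ b₂ b₃) : a₁ ≠ b₂ := by
  rintro rfl
  exact h.m12 h.p1.symm

end IsNet

variable [Fintype V]

/-- The net is `q`-heavy, with the vertices `a₁` and `b₁` heavy. -/
structure IsQNet (G : SimpleGraph V) (a₁ a₂ a₃ b₁ b₂ b₃ : V) : Prop where
  ha : IsHeavy G a₁
  hb : IsHeavy G b₁
  na₂ : ∀ y, G.Adj a₂ y → y = a₁ ∨ y = a₃ ∨ y = b₂
  na₃ : ∀ y, G.Adj a₃ y → y = a₁ ∨ y = a₂ ∨ y = b₃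
  nb₂ : ∃ c, IsHeavy G c ∧ c ≠ a₂ ∧ G.Adj b₂ c ∧ ∀ y, G.Adj b₂ y → y = a₂ ∨ y = c
  nb₃ : ∃ c, IsHeavy G c ∧ c ≠ a₃ ∧ G.Adj b₃ c ∧ ∀ y, G.Adj b₃ y → y = a₃ ∨ y = c

theorem IsQNet.swap23 {a₁ a₂ a₃ b₁ b₂ b₃ : V} (h : IsQNet G a₁ a₂ a₃ b₁ b₂ b₃) :
    IsQNet G a₁ a₃ a₂ b₁ b₃ b₂ :=
  ⟨h.ha, h.hb, h.na₃, h.na₂, h.nb₃, h.nb₂⟩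

/-- The net is `p`-heavy, contains an `o`-heavy pair, or is `q`-heavy. -/
def IsGoodNet (G : SimpleGraph V) (a₁ a₂ a₃ b₁ b₂ b₃ : V) : Prop :=
  (LargeDegreeSum G a₁ a₂ ∨ LargeDegreeSum G a₁ a₃ ∨ LargeDegreeSum G a₂ a₃) ∨
  (LargeDegreeSum G a₁ b₂ ∨ LargeDegreeSum G a₁ b₃ ∨ LargeDegreeSum G a₂ b₁ ∨
    LargeDegreeSum G a₂ b₃ ∨ LargeDegreeSum G a₃ b₁ ∨ LargeDegreeSum G a₃ b₂ ∨
    LargeDegreeSum G b₁ b₂ ∨ LargeDegreeSum G b₁ b₃ ∨ LargeDegreeSum G b₂ b₃) ∨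
  IsQNet G a₁ a₂ a₃ b₁ b₂ b₃ ∨ IsQNet G a₂ a₁ a₃ b₂ b₁ b₃ ∨ IsQNet G a₃ a₁ a₂ b₃ b₁ b₂

theorem largeDegreeSum_comm {u v : V} : LargeDegreeSum G u v ↔ LargeDegreeSum G v u :=
  ⟨LargeDegreeSum.symm, LargeDegreeSum.symm⟩

theorem isQNet_comm {a₁ a₂ a₃ b₁ b₂ b₃ : V} :
    IsQNet G a₁ a₂ a₃ b₁ b₂ b₃ ↔ IsQNet G a₁ a₃ a₂ b₁ b₃ b₂ :=
  ⟨IsQNet.swap23, IsQNet.swap23⟩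

theorem IsGoodNet.swap12 {a₁ a₂ a₃ b₁ b₂ b₃ : V} (h : IsGoodNet G a₁ a₂ a₃ b₁ b₂ b₃) :
    IsGoodNet G a₂ a₁ a₃ b₂ b₁ b₃ := by
  unfold IsGoodNet at *
  rw [largeDegreeSum_comm (u := a₂) (v := a₁), largeDegreeSum_comm (u := b₂) (v := b₁),
    isQNet_comm (a₁ := a₃) (a₂ := a₂)]
  tauto

theorem IsGoodNet.swap23 {a₁ a₂ a₃ b₁ b₂ b₃ : V} (h : IsGoodNet G a₁ a₂ a₃ b₁ b₂ b₃) :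
    IsGoodNet G a₁ a₃ a₂ b₁ b₃ b₂ := by
  unfold IsGoodNet at *
  rw [largeDegreeSum_comm (u := a₃) (v := a₂), largeDegreeSum_comm (u := b₃) (v := b₂),
    isQNet_comm (a₁ := a₁) (a₂ := a₃)]
  tauto

/-- Every induced net is `p`-heavy, contains an `o`-heavy pair, or is `q`-heavy. -/
def NetGood (G : SimpleGraph V) : Prop :=
  ∀ a₁ a₂ a₃ b₁ b₂ b₃ : V, IsNet G a₁ a₂ a₃ b₁ b₂ b₃ → IsGoodNet G a₁ a₂ a₃ b₁ b₂ b₃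

/-! ### The net invariant is preserved -/

section Step

variable {x a₁ a₂ a₃ b₁ b₂ b₃ : V}

/-- A net of the local completion with a new pendant edge. -/
theorem NetGood.of_pendant (hx : IsCEligible G x) (hG : NetGood G)
    (h : IsNet (localCompletion G x) a₁ a₂ a₃ b₁ b₂ b₃) (hnew : ¬ G.Adj a₁ b₁) :
    IsGoodNet (localCompletion G x) a₁ a₂ a₃ b₁ b₂ b₃ := by
  have e12 := h.ne12
  have e13 := h.swap23.ne12
  have e21 := h.swap12.ne12
  have e31 := h.swap23.swap12.ne12
  obtain ⟨a12, a13, a23, p1, p2, p3, n12, n13, n21, n23, n31, n32, m12, m13, m23⟩ := h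
  have da12 := a12.ne
  have da13 := a13.ne
  have da23 := a23.ne
  obtain ⟨xa1, xb1⟩ := adj_and_adj_of_new p1 hnew
  have xa2 : ¬ G.Adj x a₂ := fun h' => n21 (localCompletion_adj_of_adj e21 h' xb1)
  have xa3 : ¬ G.Adj x a₃ := fun h' => n31 (localCompletion_adj_of_adj e31 h' xb1)
  have xb2 : ¬ G.Adj x b₂ := fun h' => n12 (localCompletion_adj_of_adj e12 xa1 h')
  have xb3 : ¬ G.Adj x b₃ := fun h' => n13 (localCompletion_adj_of_adj e13 xa1 h')
  have k1 := not_adj_of_localCompletion n21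
  have k2 := not_adj_of_localCompletion n31
  have xna2 : x ≠ a₂ := by rintro rfl; exact k1 xb1
  have xna3 : x ≠ a₃ := by rintro rfl; exact k2 xb1
  -- The only neighbours of `x` in the net are `a₁` and `b₁`, so `x` can take the place of `b₁` in
  -- `G`.
  have hnet : IsNet G a₁ a₂ a₃ x b₂ b₃ :=
    ⟨adj_of_localCompletion_adj_right xa2 a12, adj_of_localCompletion_adj_right xa3 a13,
      adj_of_localCompletion_adj_right xa3 a23, xa1.symm, adj_of_localCompletion_adj_left xa2 p2,
      adj_of_localCompletion_adj_left xa3 p3, not_adj_of_localCompletion n12,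
      not_adj_of_localCompletion n13, fun h => xa2 h.symm, not_adj_of_localCompletion n23,
      fun h => xa3 h.symm, not_adj_of_localCompletion n32, xb2, xb3,
      not_adj_of_localCompletion m23⟩
  have nbr : ∀ y z, ¬ G.Adj x y → (localCompletion G x).Adj y z → G.Adj y z :=
    fun y z => adj_of_localCompletion_adj_left
  -- If `x` were a degree-2 pendant vertex of a $q$-heavy net, then $N(x)=\{a_1,b_1\}$ with
  -- $d(a_1)\le 3$ and $d(b_1)\le n-4$, leaving `a₁` isolated. The vertex `z` would be `c₂` or `c₃`,
  -- of degree at most $n-3$, too small to pair with `x`.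
  have bad : ∀ c₂ c₃ d₂ d₃ : V, a₁ ≠ c₂ → a₁ ≠ c₃ → c₂ ≠ c₃ → b₁ ≠ c₂ → b₁ ≠ c₃ → x ≠ c₂ → x ≠ c₃ →
      ¬ G.Adj c₂ b₁ → ¬ G.Adj c₃ b₁ → ¬ G.Adj x c₂ → ¬ G.Adj x c₃ →
      ¬ IsQNet G c₂ a₁ c₃ d₂ x d₃ := by
    intro c₂ c₃ d₂ d₃ f1 f2 f3 f4 f5 g1 g2 k1 k2 k3 k4 hq
    obtain ⟨-, -, na, -, ⟨c, -, hca, hxc, hnx⟩, -⟩ := hq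
    have hc : c = b₁ := by
      rcases hnx b₁ xb1 with h' | h'
      · exact absurd h'.symm p1.ne
      · exact h'.symm
    subst hc
    have hiso : ∀ w, G.Adj x w → ¬ (bcGraph G x).Adj a₁ w := by
      intro w hw ha
      rcases hnx w hw with rfl | rfl
      · exact ha.ne rfl
      · rcases bcGraph_adj.1 ha with ha | ⟨-, -, -, -, ha⟩
        · exact hnew ha
        · have h1 := deg_le_three na
          have h2 : deg G w + 4 ≤ Fintype.card V :=
            deg_add_four_le hca f4 f5 f1 f2 f3 (fun h' => hnew h'.symm) (fun h' => k1 h'.symm)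
              (fun h' => k2 h'.symm)
          rw [largeDegreeSum_iff] at ha
          omega
    obtain ⟨z, ⟨hz1, hz2, hz3⟩, hz⟩ := hx.exists_of_isolated xa1 hiso
    have h1 := deg_le_two hnx
    have h2 : deg G z + 3 ≤ Fintype.card V := by
      rcases na z hz.symm with rfl | rfl | rfl
      · exact deg_add_three_le g1.symm f4.symm xb1.ne (fun h' => k3 h'.symm) k1
      · exact deg_add_three_le g2.symm f5.symm xb1.ne (fun h' => k4 h'.symm) k2
      · exact absurd rfl hz1
    rw [largeDegreeSum_iff] at hz3
    omega
  have L : ∀ u v, LargeDegreeSum G u v → LargeDegreeSum (localCompletion G x) u v :=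
    fun u v h => h.mono le_localCompletion
  have X : ∀ u, LargeDegreeSum G u x → LargeDegreeSum (localCompletion G x) u b₁ :=
    fun u h => (h.symm.localCompletion_left xb1).symm
  have X' : ∀ u, LargeDegreeSum G x u → LargeDegreeSum (localCompletion G x) b₁ u :=
    fun u h => h.localCompletion_left xb1
  rcases hG _ _ _ _ _ _ hnet with h | h | h | h | h
  · left
    rcases h with h | h | h <;> simp [L _ _ h]
  · right; left
    rcases h with h | h | h | h | h | h | h | h | h
    · simp [L _ _ h]
    · simp [L _ _ h]
    · simp [X _ h]
    · simp [L _ _ h]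
    · simp [X _ h]
    · simp [L _ _ h]
    · simp [X' _ h]
    · simp [X' _ h]
    · simp [L _ _ h]
  · right; right; left
    obtain ⟨ha, hb, na2, na3, ⟨c, hc1, hc2, hc3, hc4⟩, ⟨d, hd1, hd2, hd3, hd4⟩⟩ := h
    exact ⟨ha.mono le_localCompletion, hb.localCompletion xb1,
      fun y hy => na2 y (nbr _ _ xa2 hy), fun y hy => na3 y (nbr _ _ xa3 hy),
      ⟨c, hc1.mono le_localCompletion, hc2, le_localCompletion hc3,
        fun y hy => hc4 y (nbr _ _ xb2 hy)⟩,
      ⟨d, hd1.mono le_localCompletion, hd2, le_localCompletion hd3,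
        fun y hy => hd4 y (nbr _ _ xb3 hy)⟩⟩
  · exact absurd h (bad a₂ a₃ b₂ b₃ da12 da13 da23 e21.symm e31.symm xna2 xna3 k1 k2 xa2 xa3)
  · exact absurd h (bad a₃ a₂ b₃ b₂ da13 da12 da23.symm e31.symm e21.symm xna3 xna2 k2 k1 xa3 xa2)

/-- A net of the local completion whose new edges lie in the triangle. -/
theorem NetGood.of_triangle (hcl : ClawOHeavy G) (hG : NetGood G)
    (h : IsNet (localCompletion G x) a₁ a₂ a₃ b₁ b₂ b₃) (hp1 : G.Adj a₁ b₁) (hp2 : G.Adj a₂ b₂)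
    (hp3 : G.Adj a₃ b₃) (hnew : ¬ G.Adj a₁ a₂) :
    IsGoodNet (localCompletion G x) a₁ a₂ a₃ b₁ b₂ b₃ := by
  have e12 := h.ne12
  have e13 := h.swap23.ne12
  have e21 := h.swap12.ne12
  have e23 := h.swap12.swap23.ne12
  have e31 := h.swap23.swap12.ne12
  obtain ⟨a12, a13, a23, p1, p2, p3, n12, n13, n21, n23, n31, n32, m12, m13, m23⟩ := h
  have da12 := a12.ne
  have da13 := a13.ne
  have da23 := a23.ne
  obtain ⟨xa1, xa2⟩ := adj_and_adj_of_new a12 hnew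
  have xb1 : ¬ G.Adj x b₁ := fun h' => n21 (localCompletion_adj_of_adj e21 xa2 h')
  have xb2 : ¬ G.Adj x b₂ := fun h' => n12 (localCompletion_adj_of_adj e12 xa1 h')
  have xb3 : ¬ G.Adj x b₃ := fun h' => n13 (localCompletion_adj_of_adj e13 xa1 h')
  have hN : ∀ u v, ¬ (localCompletion G x).Adj u v → ¬ G.Adj u v :=
    fun u v => not_adj_of_localCompletion
  have m21 : ¬ G.Adj b₂ b₁ := fun h' => hN _ _ m12 h'.symm
  replace n12 := hN _ _ n12
  replace n13 := hN _ _ n13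
  replace n21 := hN _ _ n21
  replace n23 := hN _ _ n23
  replace n31 := hN _ _ n31
  replace n32 := hN _ _ n32
  replace m13 := hN _ _ m13
  replace m23 := hN _ _ m23
  have xna3 : x ≠ a₃ := by rintro rfl; exact xb3 hp3
  have xnb1 : x ≠ b₁ := by rintro rfl; exact n21 xa2.symm
  have xnb2 : b₂ ≠ x := by rintro rfl; exact n12 xa1.symm
  have L : ∀ u v, LargeDegreeSum G u v → LargeDegreeSum (localCompletion G x) u v :=
    fun u v h => h.mono le_localCompletion
  by_cases xa3 : G.Adj x a₃
  -- Exactly one of the edges to `a₃` is old: `x`, `c`, `a₃` with pendants `d`, `e`, `b₃` is a net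
  -- of `G`. If it is $q$-heavy, either `x` passes its heaviness to `d` and `a₃`, or `d` has degree
  -- 2 and its other neighbour `f` is heavy, as is `e` or `b₃`.
  · have aux : ∀ c d e f : V, G.Adj x c → G.Adj x d → ¬ G.Adj c d → G.Adj c a₃ →
        ¬ G.Adj d a₃ → G.Adj c e → G.Adj d f → ¬ G.Adj x e →
        ¬ G.Adj c b₃ → ¬ G.Adj a₃ e → ¬ G.Adj d e → ¬ G.Adj d b₃ → ¬ G.Adj e b₃ →
        f ≠ x →
        LargeDegreeSum (localCompletion G x) c d ∨ LargeDegreeSum (localCompletion G x) c a₃ ∨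
        LargeDegreeSum (localCompletion G x) d a₃ ∨ LargeDegreeSum (localCompletion G x) d e ∨
        LargeDegreeSum (localCompletion G x) d b₃ ∨ LargeDegreeSum (localCompletion G x) c b₃ ∨
        LargeDegreeSum (localCompletion G x) a₃ e ∨ LargeDegreeSum (localCompletion G x) e b₃ ∨
        LargeDegreeSum (localCompletion G x) e f ∨ LargeDegreeSum (localCompletion G x) b₃ f := by
      intro c d e f xc xd ncd hca nda hce hdf xe ncb nae nde ndb neb hfx
      have hnet : IsNet G x c a₃ d e b₃ :=
        ⟨xc, xa3, hca, xd, hce, hp3, xe, xb3, ncd, ncb, fun h' => nda h'.symm, nae, nde, ndb, neb⟩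
      rcases hG _ _ _ _ _ _ hnet with (h | h | h) | (h | h | h | h | h | h | h | h | h) | h | h | h
      · simp [(h.localCompletion_left xd).symm]
      · simp [h.localCompletion_left xd]
      · simp [L _ _ h]
      · simp [h.localCompletion_left xd]
      · simp [h.localCompletion_left xd]
      · simp [L _ _ h]
      · simp [L _ _ h]
      · simp [(L _ _ h).symm]
      · simp [L _ _ h]
      · simp [L _ _ h]
      · simp [L _ _ h]
      · simp [L _ _ h]
      · simp [((h.ha.localCompletion xd).largeDegreeSum (h.ha.localCompletion xa3))]
      · obtain ⟨g, hg, -, -, hg4⟩ := h.nb₂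
        have : f = g := (hg4 f hdf).resolve_left hfx
        subst this
        simp [L _ _ (h.hb.largeDegreeSum hg)]
      · obtain ⟨g, hg, -, -, hg4⟩ := h.nb₂
        have : f = g := (hg4 f hdf).resolve_left hfx
        subst this
        simp [L _ _ (h.hb.largeDegreeSum hg)]
    by_cases h13 : G.Adj a₁ a₃
    · by_cases h23 : G.Adj a₂ a₃
      · rcases hcl a₃ a₁ a₂ b₃ h13.symm h23.symm hp3 da12 e13 e23 hnew n13 n23
          with h | h | h
        · left; simp [L _ _ h]
        · right; left; simp [L _ _ h]
        · right; left; simp [L _ _ h]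
      · rcases aux a₁ a₂ b₁ b₂ xa1 xa2 hnew h13 h23 hp1 hp2 xb1
          n13 n31 n21 n23 m13 xnb2
          with h | h | h | h | h | h | h | h | h | h
        · left; simp [h]
        · left; simp [h]
        · left; simp [h]
        · right; left; simp [h]
        · right; left; simp [h]
        · right; left; simp [h]
        · right; left; simp [h]
        · right; left; simp [h]
        · right; left; simp [h]
        · right; left; simp [h.symm]
    · by_cases h23 : G.Adj a₂ a₃
      · rcases aux a₂ a₁ b₂ b₁ xa2 xa1 (fun h' => hnew h'.symm) h23 h13 hp2 hp1 xb2
          n23 n32 n12 n13 m23 xnb1.symm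
          with h | h | h | h | h | h | h | h | h | h
        · left; simp [h.symm]
        · left; simp [h]
        · left; simp [h]
        · right; left; simp [h]
        · right; left; simp [h]
        · right; left; simp [h]
        · right; left; simp [h]
        · right; left; simp [h]
        · right; left; simp [h.symm]
        · right; left; simp [h.symm]
      · left
        rcases hcl x a₁ a₂ a₃ xa1 xa2 xa3 da12 da13 da23 hnew h13 h23 with h | h | h <;>
          simp [L _ _ h]
  · have h13 : G.Adj a₁ a₃ := adj_of_localCompletion_adj_right xa3 a13
    rcases hcl a₁ x a₃ b₁ xa1.symm h13 hp1 xna3 xnb1 e31 xa3 xb1 n31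
      with h | h | h
    · left; simp [h.localCompletion_left xa1]
    · right; left; simp [h.localCompletion_left xa2]
    · right; left; simp [L _ _ h]

/-- In a `q`-heavy net, the heavy neighbour of `b₂` does not have a large degree sum with `a₂`. -/
theorem IsQNet.not_largeDegreeSum (hcl : ClawOHeavy G) (h : IsNet G a₁ a₂ a₃ b₁ b₂ b₃)
    (hq : IsQNet G a₁ a₂ a₃ b₁ b₂ b₃) {c : V} (hca : c ≠ a₂) (hbc : G.Adj b₂ c)
    (hnb : ∀ y, G.Adj b₂ y → y = a₂ ∨ y = c) : ¬ LargeDegreeSum G a₂ c := by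
  intro hl
  have e12 := h.ne12
  have e13 := h.swap23.ne12
  have hb23 := h.swap12.swap23.b12
  have hb13 := h.swap23.b12
  have hca1 : c ≠ a₁ := by rintro rfl; exact h.n12 hbc.symm
  have hca3 : c ≠ a₃ := by rintro rfl; exact h.n32 hbc.symm
  have hcb3 : c ≠ b₃ := by rintro rfl; exact h.m23 hbc
  have hnca2 : ¬ G.Adj c a₂ := by
    intro h'
    rcases hq.na₂ c h'.symm with h1 | h1 | h1
    · exact hca1 h1
    · exact hca3 h1
    · exact hbc.ne h1.symm
  have hnca3 : ¬ G.Adj c a₃ := by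
    intro h'
    rcases hq.na₃ c h'.symm with h1 | h1 | h1
    · exact hca1 h1
    · exact hca h1
    · exact hcb3 h1
  have d2 := deg_le_three hq.na₂
  rw [largeDegreeSum_iff] at hl
  -- From $d(a_2)\le 3$ comes $d(c)\ge n-3$, so `c` misses only itself, `a₂` and `a₃`. It then
  -- centres a claw with leaves `b₂`, `b₃`, `a₁`, whose degrees are too small for an $o$-heavy pair.
  have huniv : ∀ y, c ≠ y → a₂ ≠ y → a₃ ≠ y → G.Adj c y := by
    intro y h1 h2 h3
    by_contra hy
    have := deg_add_four_le hca hca3 h1 h.a23.ne h2 h3 hnca2 hnca3 hy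
    omega
  have da1 : deg G a₁ + 3 ≤ Fintype.card V := deg_add_three_le e12 e13 hb23 h.n12 h.n13
  have db3 : deg G b₃ + 3 ≤ Fintype.card V :=
    deg_add_three_le hb13.symm hb23.symm h.b12 (fun h' => h.m13 h'.symm) (fun h' => h.m23 h'.symm)
  have db2 := deg_le_two hnb
  have db3' : deg G b₃ ≤ 2 := by
    obtain ⟨_, -, -, -, h'⟩ := hq.nb₃
    exact deg_le_two h'
  rcases hcl c b₂ b₃ a₁ hbc.symm (huniv _ hcb3 h.swap12.swap23.ne12 h.p3.ne)
    (huniv _ hca1 h.a12.ne.symm h.a13.ne.symm) hb23 e12.symm e13.symm h.m23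
    (fun h' => h.n12 h'.symm) (fun h' => h.n13 h'.symm) with h' | h' | h' <;>
    rw [largeDegreeSum_iff] at h' <;> omega

/-- A net present in both graphs: the neighbourhoods of `a₂` and `b₂` are unchanged. -/
theorem IsQNet.adj_of_localCompletion_adj (hx : IsCEligible G x) (hcl : ClawOHeavy G)
    (h : IsNet G a₁ a₂ a₃ b₁ b₂ b₃) (h' : IsNet (localCompletion G x) a₁ a₂ a₃ b₁ b₂ b₃)
    (hq : IsQNet G a₁ a₂ a₃ b₁ b₂ b₃) :
    (∀ y, (localCompletion G x).Adj a₂ y → G.Adj a₂ y) ∧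
      ∀ y, (localCompletion G x).Adj b₂ y → G.Adj b₂ y := by
  obtain ⟨c, -, hca, hbc, hnb⟩ := hq.nb₂
  have hnot := hq.not_largeDegreeSum hcl h hca hbc hnb
  have e12 := h.ne12
  have e13 := h.swap23.ne12
  have e21 := h.swap12.ne12
  have e31 := h.swap23.swap12.ne12
  have e32 := h.swap23.swap12.swap23.ne12
  have hb23 := h.swap12.swap23.b12
  have da1 : deg G a₁ + 3 ≤ Fintype.card V := deg_add_three_le e12 e13 hb23 h.n12 h.n13
  have da3 : deg G a₃ + 3 ≤ Fintype.card V := deg_add_three_le e31 e32 h.b12 h.n31 h.n32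
  have db2 := deg_le_two hnb
  have hnca2 : ¬ G.Adj c a₂ := by
    intro h''
    rcases hq.na₂ c h''.symm with rfl | rfl | rfl
    · exact h.n12 hbc.symm
    · exact h.n32 hbc.symm
    · exact hbc.ne rfl
  constructor
  · intro y hy
    by_contra hn
    have hxa : G.Adj a₂ x := by
      rw [localCompletion_adj] at hy
      exact (hy.resolve_left hn).2.1.symm
    rcases hq.na₂ x hxa with rfl | rfl | rfl
    · exact h'.n21 (localCompletion_adj_of_adj e21 h.a12 h.p1)
    · exact h'.n23 (localCompletion_adj_of_adj h.swap12.swap23.ne12 h.a23.symm h.p3)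
    -- Here `x` is `b₂`, with neighbours `a₂` and `c` only. The vertex `z` is then `a₁` or `a₃`, of
    -- degree at most $n-3$, against $d(b_2)\le 2$.
    · have hiso : ∀ w, G.Adj x w → ¬ (bcGraph G x).Adj a₂ w := by
        intro w hw ha
        rcases hnb w hw with rfl | rfl
        · exact ha.ne rfl
        · rcases bcGraph_adj.1 ha with ha | ⟨-, -, -, -, ha⟩
          · exact hnca2 ha.symm
          · exact hnot ha
      obtain ⟨z, ⟨hz1, hz2, hz3⟩, hz⟩ := hx.exists_of_isolated h.p2.symm hiso
      rw [largeDegreeSum_iff] at hz3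
      rcases hq.na₂ z hz.symm with rfl | rfl | rfl
      · omega
      · omega
      · exact hz1 rfl
  · intro y hy
    by_contra hn
    have hxb : G.Adj b₂ x := by
      rw [localCompletion_adj] at hy
      exact (hy.resolve_left hn).2.1.symm
    rcases hnb x hxb with rfl | rfl
    · exact h'.n12 (localCompletion_adj_of_adj e12 h.a12.symm h.p2)
    -- Here `x` is `c`. A vertex $o$-heavy with `b₂` needs degree at least $n-2$, but all its
    -- non-neighbours have degree at most $n-3$. The vertex `z` can only be `a₂`, which `hnot`
    -- excludes.
    · have hiso : ∀ w, G.Adj x w → ¬ (bcGraph G x).Adj b₂ w := by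
        intro w hw ha
        rcases bcGraph_adj.1 ha with ha | ⟨-, -, h1, h2, h3⟩
        · rcases hnb w ha with rfl | rfl
          · exact hnca2 hw
          · exact hw.ne rfl
        · have hwd : deg G w + 3 ≤ Fintype.card V := by
            by_cases hwa : G.Adj a₂ w
            · rcases hq.na₂ w hwa with rfl | rfl | rfl
              · exact da1
              · exact da3
              · exact absurd rfl h1
            · exact deg_add_three_le h1.symm (by rintro rfl; exact h2 h.p2.symm) h.p2.ne.symm
                (fun h' => h2 h'.symm) (fun h' => hwa h'.symm)
          rw [largeDegreeSum_iff] at h3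
          omega
      obtain ⟨z, ⟨hz1, hz2, hz3⟩, hz⟩ := hx.exists_of_isolated hxb.symm hiso
      rcases hnb z hz.symm with rfl | rfl
      · exact hnot hz3.symm
      · exact hz1 rfl

theorem IsQNet.localCompletion (hx : IsCEligible G x) (hcl : ClawOHeavy G)
    (h : IsNet G a₁ a₂ a₃ b₁ b₂ b₃) (h' : IsNet (localCompletion G x) a₁ a₂ a₃ b₁ b₂ b₃)
    (hq : IsQNet G a₁ a₂ a₃ b₁ b₂ b₃) : IsQNet (localCompletion G x) a₁ a₂ a₃ b₁ b₂ b₃ := by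
  obtain ⟨h2, k2⟩ := hq.adj_of_localCompletion_adj hx hcl h h'
  obtain ⟨h3, k3⟩ := hq.swap23.adj_of_localCompletion_adj hx hcl h.swap23 h'.swap23
  obtain ⟨ha, hb, na2, na3, ⟨c, hc1, hc2, hc3, hc4⟩, ⟨d, hd1, hd2, hd3, hd4⟩⟩ := hq
  exact ⟨ha.mono le_localCompletion, hb.mono le_localCompletion,
    fun y hy => na2 y (h2 y hy), fun y hy => na3 y (h3 y hy),
    ⟨c, hc1.mono le_localCompletion, hc2, le_localCompletion hc3, fun y hy => hc4 y (k2 y hy)⟩,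
    ⟨d, hd1.mono le_localCompletion, hd2, le_localCompletion hd3, fun y hy => hd4 y (k3 y hy)⟩⟩

theorem NetGood.of_isNet (hx : IsCEligible G x) (hcl : ClawOHeavy G) (hG : NetGood G)
    (h : IsNet G a₁ a₂ a₃ b₁ b₂ b₃) (h' : IsNet (localCompletion G x) a₁ a₂ a₃ b₁ b₂ b₃) :
    IsGoodNet (localCompletion G x) a₁ a₂ a₃ b₁ b₂ b₃ := by
  have L : ∀ u v, LargeDegreeSum G u v → LargeDegreeSum (localCompletion G x) u v :=
    fun u v h => h.mono le_localCompletion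
  rcases hG _ _ _ _ _ _ h with hp | ho | hq | hq | hq
  · exact Or.inl (hp.imp (L _ _) (Or.imp (L _ _) (L _ _)))
  · refine Or.inr (Or.inl ?_)
    rcases ho with h | h | h | h | h | h | h | h | h <;> simp [L _ _ h]
  · exact Or.inr (Or.inr (Or.inl (hq.localCompletion hx hcl h h')))
  · exact Or.inr (Or.inr (Or.inr (Or.inl (hq.localCompletion hx hcl h.swap12 h'.swap12))))
  · exact Or.inr (Or.inr (Or.inr (Or.inr
      (hq.localCompletion hx hcl h.swap23.swap12 h'.swap23.swap12))))

theorem NetGood.localCompletion (hx : IsCEligible G x) (hcl : ClawOHeavy G) (hG : NetGood G) :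
    NetGood (localCompletion G x) := by
  intro a₁ a₂ a₃ b₁ b₂ b₃ h
  by_cases hp1 : G.Adj a₁ b₁
  swap
  · exact hG.of_pendant hx h hp1
  by_cases hp2 : G.Adj a₂ b₂
  swap
  · exact (hG.of_pendant hx h.swap12 hp2).swap12
  by_cases hp3 : G.Adj a₃ b₃
  swap
  · exact (hG.of_pendant hx h.swap23.swap12 hp3).swap12.swap23
  by_cases h12 : G.Adj a₁ a₂
  swap
  · exact hG.of_triangle hcl h hp1 hp2 hp3 h12
  by_cases h13 : G.Adj a₁ a₃
  swap
  · exact (hG.of_triangle hcl h.swap23 hp1 hp3 hp2 h13).swap23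
  by_cases h23 : G.Adj a₂ a₃
  swap
  · exact (hG.of_triangle hcl h.swap12.swap23 hp2 hp3 hp1 h23).swap23.swap12
  have N : ∀ u v, ¬ (CClosure.localCompletion G x).Adj u v → ¬ G.Adj u v :=
    fun u v h h' => h (le_localCompletion h')
  exact hG.of_isNet hx hcl ⟨h12, h13, h23, hp1, hp2, hp3, N _ _ h.n12, N _ _ h.n13, N _ _ h.n21,
    N _ _ h.n23, N _ _ h.n31, N _ _ h.n32, N _ _ h.m12, N _ _ h.m13, N _ _ h.m23⟩ h

end Step

/-! ### Translation between embeddings and explicit nets -/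

section Embeddings

/-- The exact degrees 3 and 2 become lists of the possible neighbours, the form that the step
arguments transfer. -/
theorem IsNPQHeavy.netGood (h : IsNPQHeavy G) : NetGood G := by
  classical
  intro a₁ a₂ a₃ b₁ b₂ b₃ hn
  have hb12 := hn.b12
  have hb13 := hn.swap23.b12
  have hb23 := hn.swap12.swap23.b12
  have e12 := hn.ne12
  have e13 := hn.swap23.ne12
  have e21 := hn.swap12.ne12
  have e23 := hn.swap12.swap23.ne12
  have e31 := hn.swap23.swap12.ne12
  have e32 := hn.swap23.swap12.swap23.ne12
  have d12 := hn.a12.ne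
  have d13 := hn.a13.ne
  have d23 := hn.a23.ne
  have c1 := hn.p1.ne
  have c2 := hn.p2.ne
  have c3 := hn.p3.ne
  let f : net ↪g G :=
    { toFun := Sum.elim ![a₁, a₂, a₃] ![b₁, b₂, b₃]
      inj' := by
        rintro (i | i) (j | j) hij <;> fin_cases i <;> fin_cases j <;>
          simp [hb12, hb13, hb23, e12, e13, e21, e23, e31, e32, d12, d13, d23, c1, c2, c3,
            hb12.symm, hb13.symm, hb23.symm, e12.symm, e13.symm, e21.symm, e23.symm, e31.symm,
            e32.symm, d12.symm, d13.symm, d23.symm, c1.symm, c2.symm, c3.symm] at hij ⊢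
      map_rel_iff' := by
        obtain ⟨a12, a13, a23, p1, p2, p3, n12, n13, n21, n23, n31, n32, m12, m13, m23⟩ := hn
        have n21' : ¬ G.Adj b₂ a₁ := fun h => n12 h.symm
        have n31' : ¬ G.Adj b₃ a₁ := fun h => n13 h.symm
        have n12' : ¬ G.Adj b₁ a₂ := fun h => n21 h.symm
        have n32' : ¬ G.Adj b₃ a₂ := fun h => n23 h.symm
        have n13' : ¬ G.Adj b₁ a₃ := fun h => n31 h.symm
        have n23' : ¬ G.Adj b₂ a₃ := fun h => n32 h.symm
        have m21 : ¬ G.Adj b₂ b₁ := fun h => m12 h.symm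
        have m31 : ¬ G.Adj b₃ b₁ := fun h => m13 h.symm
        have m32 : ¬ G.Adj b₃ b₂ := fun h => m23 h.symm
        intro i j
        change G.Adj (Sum.elim ![a₁, a₂, a₃] ![b₁, b₂, b₃] i)
          (Sum.elim ![a₁, a₂, a₃] ![b₁, b₂, b₃] j) ↔ _
        rcases i with i | i <;> rcases j with j | j <;> fin_cases i <;> fin_cases j <;>
          simp [net, a12, a13, a23, p1, p2, p3, n12, n13, n21, n23, n31, n32, m12, m13, m23,
            a12.symm, a13.symm, a23.symm, p1.symm, p2.symm, p3.symm, n21', n31', n12', n32', n13',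
            n23', m21, m31, m32] }
  have deg2 : ∀ a b : V, G.Adj b a → deg G b = 2 →
      (∀ c, G.Adj b c → c ≠ a → IsHeavy G c) →
      ∃ c, IsHeavy G c ∧ c ≠ a ∧ G.Adj b c ∧ ∀ y, G.Adj b y → y = a ∨ y = c := by
    intro a b hab hd hc
    have : ∃ c, G.Adj b c ∧ c ≠ a := by
      by_contra! hcon
      have := deg_le_card (G := G) (v := b) {a} (by simpa using hcon)
      simp only [Finset.card_singleton] at this
      omega
    obtain ⟨c, hbc, hca⟩ := this
    refine ⟨c, hc c hbc hca, hca, hbc, fun y hy => ?_⟩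
    have := mem_of_deg_le_card (G := G) (v := b) {a, c} (by simp [hab, hbc])
      (by rw [hd, Finset.card_pair hca.symm]) hy
    simpa using this
  have deg3 : ∀ v p q r : V, G.Adj v p → G.Adj v q → G.Adj v r → p ≠ q → p ≠ r → q ≠ r →
      deg G v = 3 → ∀ y, G.Adj v y → y = p ∨ y = q ∨ y = r := by
    intro v p q r hp hq hr hpq hpr hqr hd y hy
    have := mem_of_deg_le_card (G := G) (v := v) {p, q, r} (by simp [hp, hq, hr])
      (by rw [hd, Finset.card_eq_three.2 ⟨p, q, r, hpq, hpr, hqr, rfl⟩]) hy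
    simpa using this
  have fl0 : f (.inl 0) = a₁ := rfl
  have fl1 : f (.inl 1) = a₂ := rfl
  have fl2 : f (.inl 2) = a₃ := rfl
  have fr0 : f (.inr 0) = b₁ := rfl
  have fr1 : f (.inr 1) = b₂ := rfl
  have fr2 : f (.inr 2) = b₃ := rfl
  have hdeg : ∀ v k, G.degree v = k → deg G v = k := by
    intro v k hk
    exact hk
  rcases h f with ⟨i, j, hadj, hl⟩ | ⟨i, h1, h2, h3⟩
  · left
    fin_cases i <;> fin_cases j <;> simp only [Fin.zero_eta, Fin.mk_one, Fin.reduceFinMk, fl0, fl1,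
      fl2] at hadj hl
    · exact absurd rfl hadj.ne
    · exact Or.inl hl
    · exact Or.inr (Or.inl hl)
    · exact Or.inl hl.symm
    · exact absurd rfl hadj.ne
    · exact Or.inr (Or.inr hl)
    · exact Or.inr (Or.inl hl.symm)
    · exact Or.inr (Or.inr hl.symm)
    · exact absurd rfl hadj.ne
  · right; right
    have Q0 := h3 0
    have Q1 := h3 1
    have Q2 := h3 2
    fin_cases i <;> simp only [Fin.zero_eta, Fin.mk_one, Fin.reduceFinMk, fl0, fl1, fl2, fr0, fr1,
      fr2] at h1 h2 Q0 Q1 Q2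
    · left
      obtain ⟨x1, x2, x3⟩ := Q1 (by decide)
      obtain ⟨y1, y2, y3⟩ := Q2 (by decide)
      exact ⟨h1, h2, deg3 _ _ _ _ hn.a12.symm hn.a23 hn.p2 d13 e12 e32 (hdeg _ _ x1),
        deg3 _ _ _ _ hn.a13.symm hn.a23.symm hn.p3 d12 e13 e23 (hdeg _ _ y1),
        deg2 _ _ hn.p2.symm (hdeg _ _ x2) x3, deg2 _ _ hn.p3.symm (hdeg _ _ y2) y3⟩
    · right; left
      obtain ⟨x1, x2, x3⟩ := Q0 (by decide)
      obtain ⟨y1, y2, y3⟩ := Q2 (by decide)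
      exact ⟨h1, h2, deg3 _ _ _ _ hn.a12 hn.a13 hn.p1 d23 e21 e31 (hdeg _ _ x1),
        deg3 _ _ _ _ hn.a23.symm hn.a13.symm hn.p3 d12.symm e23 e13 (hdeg _ _ y1),
        deg2 _ _ hn.p1.symm (hdeg _ _ x2) x3, deg2 _ _ hn.p3.symm (hdeg _ _ y2) y3⟩
    · right; right
      obtain ⟨x1, x2, x3⟩ := Q0 (by decide)
      obtain ⟨y1, y2, y3⟩ := Q1 (by decide)
      exact ⟨h1, h2, deg3 _ _ _ _ hn.a13 hn.a12 hn.p1 d23.symm e31 e21 (hdeg _ _ x1),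
        deg3 _ _ _ _ hn.a23 hn.a12.symm hn.p2 d13.symm e32 e12 (hdeg _ _ y1),
        deg2 _ _ hn.p1.symm (hdeg _ _ x2) x3, deg2 _ _ hn.p2.symm (hdeg _ _ y2) y3⟩

/-- Without $o$-heavy pairs the nine nonadjacent alternatives vanish. The edges of the net and the
witness `c` turn the neighbour lists back into exact degrees. -/
theorem NetGood.isNPQHeavy (h : NetGood G) (ho : ∀ u v, ¬ IsOHeavyPair G u v) :
    IsNPQHeavy G := by
  classical
  intro f
  have A : ∀ i j, i ≠ j → G.Adj (f (.inl i)) (f (.inl j)) := fun i j hij => f.map_rel_iff.2 hij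
  have P : ∀ i, G.Adj (f (.inl i)) (f (.inr i)) := fun i => f.map_rel_iff.2 rfl
  have N : ∀ i j, i ≠ j → ¬ G.Adj (f (.inl i)) (f (.inr j)) :=
    fun i j hij h => hij (f.map_rel_iff.1 h)
  have M : ∀ i j, ¬ G.Adj (f (.inr i)) (f (.inr j)) := fun i j h => f.map_rel_iff.1 h
  have O : ∀ i j, i ≠ j → ¬ LargeDegreeSum G (f (.inl i)) (f (.inr j)) :=
    fun i j hij h => ho _ _ ⟨fun he => by simpa using f.injective he, N i j hij, h⟩
  have O' : ∀ i j, i ≠ j → ¬ LargeDegreeSum G (f (.inr i)) (f (.inr j)) :=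
    fun i j hij h => ho _ _ ⟨fun he => hij (by simpa using f.injective he), M i j, h⟩
  have hn : IsNet G (f (.inl 0)) (f (.inl 1)) (f (.inl 2)) (f (.inr 0)) (f (.inr 1))
      (f (.inr 2)) :=
    ⟨A _ _ (by decide), A _ _ (by decide), A _ _ (by decide), P _, P _, P _, N _ _ (by decide),
      N _ _ (by decide), N _ _ (by decide), N _ _ (by decide), N _ _ (by decide),
      N _ _ (by decide), M _ _, M _ _, M _ _⟩
  have Q : ∀ i j k : Fin 3, i ≠ j → i ≠ k → j ≠ k →
      IsQNet G (f (.inl i)) (f (.inl j)) (f (.inl k)) (f (.inr i)) (f (.inr j)) (f (.inr k)) →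
      IsQHeavyNet G f := by
    have half : ∀ i j k : Fin 3, i ≠ j → i ≠ k → j ≠ k →
        IsQNet G (f (.inl i)) (f (.inl j)) (f (.inl k)) (f (.inr i)) (f (.inr j)) (f (.inr k)) →
        deg G (f (.inl j)) = 3 ∧ deg G (f (.inr j)) = 2 ∧
          ∀ c : V, G.Adj (f (.inr j)) c → c ≠ f (.inl j) → IsHeavy G c := by
      intro i j k hij hik hjk hq
      obtain ⟨c, hc1, hc2, hc3, hc4⟩ := hq.nb₂
      refine ⟨le_antisymm (deg_le_three hq.na₂) ?_, le_antisymm (deg_le_two hc4) ?_, ?_⟩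
      · have := card_le_deg (G := G) (v := f (.inl j)) {f (.inl i), f (.inl k), f (.inr j)}
          (by simp [A j i hij.symm, A j k hjk, P j])
        rwa [Finset.card_eq_three.2 ⟨_, _, _, ?_, ?_, ?_, rfl⟩] at this
        · exact fun he => hik (by simpa using f.injective he)
        · exact fun he => by simpa using f.injective he
        · exact fun he => by simpa using f.injective he
      · have := card_le_deg (G := G) (v := f (.inr j)) {f (.inl j), c}
          (by simp [(P j).symm, hc3])
        rwa [Finset.card_pair hc2.symm] at this
      · intro y hy hya
        rw [(hc4 y hy).resolve_left hya]
        exact hc1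
    intro i j k hij hik hjk hq
    refine ⟨i, hq.ha, hq.hb, fun l hl => ?_⟩
    have : l = j ∨ l = k := by omega
    rcases this with rfl | rfl
    · exact half i l k hij hik hjk hq
    · exact half i l j hik hij hjk.symm hq.swap23
  rcases h _ _ _ _ _ _ hn with (h | h | h) | (h | h | h | h | h | h | h | h | h) | h | h | h
  · exact Or.inl ⟨0, 1, hn.a12, h⟩
  · exact Or.inl ⟨0, 2, hn.a13, h⟩
  · exact Or.inl ⟨1, 2, hn.a23, h⟩
  · exact absurd h (O _ _ (by decide))
  · exact absurd h (O _ _ (by decide))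
  · exact absurd h (O _ _ (by decide))
  · exact absurd h (O _ _ (by decide))
  · exact absurd h (O _ _ (by decide))
  · exact absurd h (O _ _ (by decide))
  · exact absurd h (O' _ _ (by decide))
  · exact absurd h (O' _ _ (by decide))
  · exact absurd h (O' _ _ (by decide))
  · exact Or.inr (Q 0 1 2 (by decide) (by decide) (by decide) h)
  · exact Or.inr (Q 1 0 2 (by decide) (by decide) (by decide) h)
  · exact Or.inr (Q 2 0 1 (by decide) (by decide) (by decide) h)

end Embeddings

end Nets

end CClosure

theorem mainTheorem8 {V : Type*} [Fintype V] (G : SimpleGraph V)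
    (hclaw : CClosure.IsOHeavyFor CClosure.claw G) (hnet : CClosure.IsNPQHeavy G) :
    ∀ H : SimpleGraph V, CClosure.IsCClosure G H → CClosure.IsNPQHeavy H := by
  rintro H ⟨hsteps, hclosed⟩
  have key : CClosure.ClawOHeavy H ∧ CClosure.NetGood H := by
    -- Only the final graph is closed, so this fact cannot accompany the induction along the
    -- sequence.
    clear hclosed
    induction hsteps with
    | refl => exact ⟨hclaw.clawOHeavy, hnet.netGood⟩
    | tail _ hstep ih =>
      obtain ⟨x, hx, rfl⟩ := hstep
      exact ⟨ih.1.localCompletion x, ih.2.localCompletion hx ih.1⟩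
  exact key.2.isNPQHeavy (key.1.not_isOHeavyPair hclosed)
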